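/- Let $n\ge 1$. Let $\mathcal B(n)$ be the set of all compact convex subsets $A\subset\mathbb R^n$ with non-empty interior and $A=-A$, equipped with the Hausdorff metric $$d_H(A,B)=\max\Big\{\sup_{b\in B}d(b,A),\ \sup_{a\in A}d(a,B)\Big\},$$ where $d$ is the Euclidean metric. The group $GL(n)$ of invertible real $n\times n$ matrices acts on $\mathcal B(n)$ by $gA=\{ga\mid a\in A\}$. Let $O(n)\subset GL(n)$ be the orthogonal group and let $J(n)\subset\mathcal B(n)$ be the ($O(n)$-invariant) subspace of all $A\in\mathcal B(n)$ for which the closed Euclidean unit ball is the maximal volume ellipsoid contained in $A$. Give the orbit spaces $\mathcal B(n)/GL(n)$ and $J(n)/O(n)$ their quotient topologies. Then $\mathcal B(n)/GL(n)$ (the Banach–Mazur compactum $BM(n)$) is compact and metrizable, and the map $J(n)/O(n)\to\mathcal B(n)/GL(n)$, $O(n)A\mapsto GL(n)A$, induced by the inclusion $J(n)\hookrightarrow\mathcal B(n)$ is a homeomorphism. -/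

import Mathlib

open scoped MatrixGroups

noncomputable section

namespace BanachMazur

/-- Euclidean `n`-space with its standard norm. -/
abbrev E (n : ℕ) : Type := EuclideanSpace ℝ (Fin n)

/-- The space `𝓑(n)` of convex bodies of `ℝⁿ` with odd symmetry about the origin: compact convex
sets with non-empty interior which are invariant under `x ↦ -x`. It carries the metric
inherited from Mathlib's `ConvexBody`, which is the Hausdorff metric. -/
abbrev SymmBody (n : ℕ) : Type :=
  {K : ConvexBody (E n) // (∀ x ∈ K, -x ∈ K) ∧ (interior (K : Set (E n))).Nonempty}

/-- The linear map of `ℝⁿ` given by an invertible real matrix. -/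
def lin {n : ℕ} (g : GL (Fin n) ℝ) : E n →L[ℝ] E n :=
  Matrix.toEuclideanCLM (n := Fin n) (𝕜 := ℝ) (g : Matrix (Fin n) (Fin n) ℝ)

theorem lin_one {n : ℕ} : lin (1 : GL (Fin n) ℝ) = ContinuousLinearMap.id ℝ (E n) := by
  simp only [lin, Units.val_one, map_one]
  rfl

theorem lin_mul {n : ℕ} (g h : GL (Fin n) ℝ) : lin (g * h) = (lin g).comp (lin h) := by
  simp only [lin, Units.val_mul, map_mul]
  rfl

theorem lin_mul_apply {n : ℕ} (g h : GL (Fin n) ℝ) (x : E n) :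
    lin (g * h) x = lin g (lin h x) := by
  rw [lin_mul]; rfl

theorem lin_inv_lin {n : ℕ} (g : GL (Fin n) ℝ) (x : E n) : lin g⁻¹ (lin g x) = x := by
  rw [← lin_mul_apply, inv_mul_cancel, lin_one]; rfl

theorem lin_lin_inv {n : ℕ} (g : GL (Fin n) ℝ) (x : E n) : lin g (lin g⁻¹ x) = x := by
  rw [← lin_mul_apply, mul_inv_cancel, lin_one]; rfl

/-- The homeomorphism of `ℝⁿ` given by an invertible real matrix. -/
def linHomeo {n : ℕ} (g : GL (Fin n) ℝ) : E n ≃ₜ E n where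
  toFun := lin g
  invFun := lin g⁻¹
  left_inv := lin_inv_lin g
  right_inv := lin_lin_inv g
  continuous_toFun := (lin g).continuous
  continuous_invFun := (lin g⁻¹).continuous

/-- The action `gA = {ga | a ∈ A}` of `GL(n)` on `𝓑(n)`. -/
instance instSMulSymmBody (n : ℕ) : SMul (GL (Fin n) ℝ) (SymmBody n) where
  smul g A :=
    ⟨{ carrier := lin g '' (A.1 : Set (E n))
       convex' := A.1.convex.linear_image (lin g).toLinearMap
       isCompact' := A.1.isCompact.image (lin g).continuous
       nonempty' := A.1.nonempty.image _ },
      by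
        rintro _ ⟨x, hx, rfl⟩
        exact ⟨-x, A.2.1 x hx, map_neg _ _⟩,
      by
        change (interior (linHomeo g '' (A.1 : Set (E n)))).Nonempty
        rw [← (linHomeo g).image_interior]
        exact A.2.2.image _⟩

theorem coe_smul {n : ℕ} (g : GL (Fin n) ℝ) (A : SymmBody n) :
    ((g • A).1 : Set (E n)) = lin g '' (A.1 : Set (E n)) := rfl

instance instMulActionSymmBody (n : ℕ) : MulAction (GL (Fin n) ℝ) (SymmBody n) where
  one_smul A := Subtype.ext <| ConvexBody.ext <| by
    rw [coe_smul, lin_one]; simp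
  mul_smul g h A := Subtype.ext <| ConvexBody.ext <| by
    simp only [coe_smul, lin_mul, Set.image_image]; rfl

/-- The orthogonal group `O(n)` as a subgroup of `GL(n)`. -/
def O (n : ℕ) : Subgroup (GL (Fin n) ℝ) where
  carrier := {g | (g : Matrix (Fin n) (Fin n) ℝ) ∈ Matrix.orthogonalGroup (Fin n) ℝ}
  one_mem' := (Matrix.orthogonalGroup (Fin n) ℝ).one_mem
  mul_mem' := fun {a b} ha hb => (Matrix.orthogonalGroup (Fin n) ℝ).mul_mem ha hb
  inv_mem' := fun {g} hg => by
    have h1 : (g : Matrix (Fin n) (Fin n) ℝ) * star (g : Matrix (Fin n) (Fin n) ℝ) = 1 :=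
      (Matrix.mem_unitaryGroup_iff).1 hg
    have h2 : ((g⁻¹ : GL (Fin n) ℝ) : Matrix (Fin n) (Fin n) ℝ)
        = star (g : Matrix (Fin n) (Fin n) ℝ) := Units.inv_eq_of_mul_eq_one_right h1
    rw [Set.mem_ofPred_eq, h2]
    exact Unitary.star_mem hg

/-- The (non-degenerate, solid) ellipsoids of `ℝⁿ`, with arbitrary centre: the images of the
closed Euclidean unit ball under invertible affine maps. -/
def IsEllipsoid {n : ℕ} (S : Set (E n)) : Prop :=
  ∃ (g : GL (Fin n) ℝ) (c : E n), S = (fun x => c + lin g x) '' Metric.closedBall 0 1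

/-- `S` is an ellipsoid of maximal volume among all ellipsoids contained in `A`. -/
def IsMaxVolumeEllipsoid {n : ℕ} (S A : Set (E n)) : Prop :=
  IsEllipsoid S ∧ S ⊆ A ∧
    ∀ T : Set (E n), IsEllipsoid T → T ⊆ A → MeasureTheory.volume T ≤ MeasureTheory.volume S

theorem isEllipsoid_image {n : ℕ} (h : GL (Fin n) ℝ) {S : Set (E n)} (hS : IsEllipsoid S) :
    IsEllipsoid (lin h '' S) := by
  obtain ⟨g, c, rfl⟩ := hS
  refine ⟨h * g, lin h c, ?_⟩
  simp only [Set.image_image, map_add, lin_mul_apply]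

theorem norm_lin_of_mem {n : ℕ} {g : GL (Fin n) ℝ} (hg : g ∈ O n) (x : E n) :
    ‖lin g x‖ = ‖x‖ := by
  have h : star (g : Matrix (Fin n) (Fin n) ℝ) * (g : Matrix (Fin n) (Fin n) ℝ) = 1 :=
    (Matrix.mem_unitaryGroup_iff').1 hg
  have h2 : (star (lin g)).comp (lin g) = ContinuousLinearMap.id ℝ (E n) := by
    have := congrArg (Matrix.toEuclideanCLM (n := Fin n) (𝕜 := ℝ)) h
    rw [map_mul, map_star, map_one] at this
    exact this
  exact (ContinuousLinearMap.norm_map_iff_adjoint_comp_self (lin g)).2 h2 x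

/-- The linear isometry of `ℝⁿ` given by an orthogonal matrix. -/
def isom {n : ℕ} {g : GL (Fin n) ℝ} (hg : g ∈ O n) : E n ≃ₗᵢ[ℝ] E n where
  toFun := lin g
  invFun := lin g⁻¹
  left_inv := lin_inv_lin g
  right_inv := lin_lin_inv g
  map_add' := map_add _
  map_smul' := map_smul _
  norm_map' := norm_lin_of_mem hg

theorem volume_image {n : ℕ} {g : GL (Fin n) ℝ} (hg : g ∈ O n) (S : Set (E n)) :
    MeasureTheory.volume (lin g '' S) = MeasureTheory.volume S := by
  have := (isom hg).measurePreserving.measure_preimage_emb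
    (isom hg).toHomeomorph.measurableEmbedding (lin g '' S)
  rw [← this]
  congr 1
  exact (Set.preimage_image_eq S (isom hg).injective)

theorem image_closedBall {n : ℕ} {g : GL (Fin n) ℝ} (hg : g ∈ O n) :
    lin g '' Metric.closedBall 0 1 = Metric.closedBall 0 1 := by
  have := (isom hg).image_closedBall 0 1
  rw [map_zero] at this
  exact this

/-- The set `J(n)` of all `A ∈ 𝓑(n)` whose maximal volume ellipsoid is the closed Euclidean unit
ball, as a subset of `𝓑(n)` invariant under the action of `O(n)`. -/
def J (n : ℕ) : SubMulAction (O n) (SymmBody n) where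
  carrier := {A | IsMaxVolumeEllipsoid (Metric.closedBall (0 : E n) 1) (A.1 : Set (E n))}
  smul_mem' := by
    rintro ⟨g, hg⟩ A ⟨hE, hsub, hmax⟩
    refine ⟨hE, ?_, ?_⟩
    · change _ ⊆ lin g '' (A.1 : Set (E n))
      rw [← image_closedBall hg]
      exact Set.image_mono hsub
    · intro T hT hTA
      have hTA' : T ⊆ lin g '' (A.1 : Set (E n)) := hTA
      have hg' : g⁻¹ ∈ O n := inv_mem hg
      rw [← volume_image hg' T]
      refine hmax _ (isEllipsoid_image _ hT) ?_
      rintro _ ⟨y, hy, rfl⟩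
      obtain ⟨x, hx, rfl⟩ := hTA' hy
      rw [lin_inv_lin]
      exact hx

/-- The Banach–Mazur compactum: the orbit space `𝓑(n)/GL(n)`, with the quotient topology. -/
abbrev BM (n : ℕ) : Type := MulAction.orbitRel.Quotient (GL (Fin n) ℝ) (SymmBody n)

/-- The orbit space `J(n)/O(n)`, with the quotient topology (`J(n)` has the subspace topology). -/
abbrev JModO (n : ℕ) : Type := MulAction.orbitRel.Quotient (O n) (J n)

/-- The map `J(n)/O(n) → 𝓑(n)/GL(n)`, `O(n)A ↦ GL(n)A`, induced by the inclusion. -/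
def inducedMap (n : ℕ) : JModO n → BM n :=
  Quotient.map (fun A : J n => (A : SymmBody n)) (by
    rintro A B ⟨g, hg⟩
    exact ⟨(g : GL (Fin n) ℝ), congrArg Subtype.val hg⟩)

end BanachMazur

end

/-!
# The Banach–Mazur compactum as `J(n)/O(n)`

A symmetric body `A` lies in `J(n)` exactly when it contains the unit ball `B` and every matrix `M`
with `M B ⊆ A` satisfies `|det M| ≤ 1` (`mem_J_iff`): an ellipsoid contained in `A` may be
recentred at the origin by averaging it with its reflection, and its volume is `|det M| vol B`.

With this description the induced map is bijective. It is surjective because `|det|` attains its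
maximum on the compact set of linear maps carrying `B` into `A`, and the inverse of a maximizer
moves `A` into `J(n)` (`exists_smul_mem_J`). It is injective because the maximal ellipsoid is unique:
if `B` and `h B` both lie in `A ∈ J(n)` and `|det h| = 1`, write `h k = P` with `k` orthogonal and
`P` positive definite; then `(1 + P)/2` maps `B` into `A`, so its determinant is at most `1`, while
`(1 + s)/2 ≥ √s` for each eigenvalue `s` of `P`, with equality only for `s = 1`, forces `P = 1`
(`mem_orthogonalGroup_of_mapsTo`).

For compactness, bodies in `J(n)` lie in a fixed ball, since a body with a distant point `x` contains
the image of `B` under `(1 + x eᵀ)/2`, `e = x/‖x‖`, whose determinant is large (`norm_le_of_mem_J`).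
The defining conditions of `J(n)` are closed for the Hausdorff metric, so `J(n)` is compact because
the nonempty compact subsets of a ball form a compact space (`isCompact_J`).

The space `𝓑(n)/GL(n)` is Hausdorff because the orbit relation is closed: when `Aₖ → A` and
`gₖ Aₖ → C`, the matrices `gₖ` and their inverses are bounded, and a limit point `g` of the `gₖ`
satisfies `g A = C` (`mem_orbit_of_tendsto`). A continuous bijection from a compact space to a
Hausdorff space is a homeomorphism, and a compact Hausdorff space with a countable base is
metrizable.
-/

namespace BanachMazur

open Metric Set Matrix Filter Topology TopologicalSpace

/-! ### A determinant criterion for membership in `J(n)` -/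

theorem det_toEuclideanCLM {n : ℕ} (M : Matrix (Fin n) (Fin n) ℝ) :
    (toEuclideanCLM (n := Fin n) (𝕜 := ℝ) M).det = M.det :=
  LinearMap.det_toLpLin 2 M

theorem volume_ellipsoid {n : ℕ} (M : Matrix (Fin n) (Fin n) ℝ) (c : E n) :
    MeasureTheory.volume
        ((fun x => c + toEuclideanCLM (n := Fin n) (𝕜 := ℝ) M x) '' closedBall (0 : E n) 1) =
      ENNReal.ofReal |M.det| * MeasureTheory.volume (closedBall (0 : E n) 1) := by
  have h : (fun x => c + toEuclideanCLM (n := Fin n) (𝕜 := ℝ) M x) '' closedBall (0 : E n) 1 =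
      (fun x => c + x) '' (toEuclideanCLM (n := Fin n) (𝕜 := ℝ) M '' closedBall (0 : E n) 1) := by
    rw [image_image]
  rw [h, image_add_left, MeasureTheory.measure_preimage_add,
    MeasureTheory.Measure.addHaar_image_continuousLinearMap]
  exact congrArg (fun d => ENNReal.ofReal |d| * _) (det_toEuclideanCLM M)

theorem mapsTo_average {n : ℕ} (A : SymmBody n) {f g : E n →L[ℝ] E n}
    (hf : MapsTo f (closedBall 0 1) (A.1 : Set (E n)))
    (hg : MapsTo g (closedBall 0 1) (A.1 : Set (E n))) :
    MapsTo ((1 / 2 : ℝ) • (f + g)) (closedBall 0 1) (A.1 : Set (E n)) := by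
  intro x hx
  have := A.1.convex (hf hx) (hg hx) (a := 1 / 2) (b := 1 / 2) (by norm_num) (by norm_num)
    (by norm_num)
  simpa [smul_add] using this

theorem neg_mem_closedBall {n : ℕ} {x : E n} (hx : x ∈ closedBall (0 : E n) 1) :
    -x ∈ closedBall (0 : E n) 1 := by
  simpa using hx

/-- Only centred ellipsoids matter for a symmetric body, and degenerate images of the ball may be
admitted, so that maximality becomes a bound on determinants of arbitrary matrices. -/
theorem mem_J_iff {n : ℕ} (A : SymmBody n) :
    A ∈ J n ↔ closedBall (0 : E n) 1 ⊆ (A.1 : Set (E n)) ∧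
      ∀ M : Matrix (Fin n) (Fin n) ℝ,
        MapsTo (toEuclideanCLM (n := Fin n) (𝕜 := ℝ) M) (closedBall 0 1) (A.1 : Set (E n)) →
          |M.det| ≤ 1 := by
  have hpos : MeasureTheory.volume (closedBall (0 : E n) 1) ≠ 0 :=
    (measure_closedBall_pos _ _ one_pos).ne'
  have hfin : MeasureTheory.volume (closedBall (0 : E n) 1) ≠ ⊤ :=
    MeasureTheory.measure_closedBall_lt_top.ne
  constructor
  · rintro ⟨-, hsub, hmax⟩
    refine ⟨hsub, fun M hM => ?_⟩
    by_cases hdet : M.det = 0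
    · simp [hdet]
    have hT := hmax ((fun x => (0 : E n) + toEuclideanCLM (n := Fin n) (𝕜 := ℝ) M x) ''
        closedBall (0 : E n) 1) ⟨GeneralLinearGroup.mkOfDetNeZero M hdet, 0, rfl⟩
      (by simpa only [zero_add] using hM.image_subset)
    rw [volume_ellipsoid] at hT
    have h1 : ENNReal.ofReal |M.det| * MeasureTheory.volume (closedBall (0 : E n) 1) ≤
        1 * MeasureTheory.volume (closedBall (0 : E n) 1) := by rwa [one_mul]
    rw [ENNReal.mul_le_mul_iff_left hpos hfin] at h1
    exact ENNReal.ofReal_le_one.1 h1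
  · rintro ⟨hsub, hmax⟩
    refine ⟨⟨1, 0, ?_⟩, hsub, ?_⟩
    · simp [lin_one]
    · rintro _ ⟨g, c, rfl⟩ hT
      have hg : MapsTo (lin g) (closedBall 0 1) (A.1 : Set (E n)) := by
        -- The centre is removed by averaging `c + g x` with the reflection of `c - g x`.
        intro x hx
        have h1 : c + lin g x ∈ (A.1 : Set (E n)) := hT ⟨x, hx, rfl⟩
        have h2 : -(c + lin g (-x)) ∈ (A.1 : Set (E n)) :=
          A.2.1 _ (hT ⟨-x, neg_mem_closedBall hx, rfl⟩)
        have := A.1.convex h1 h2 (a := 1 / 2) (b := 1 / 2) (by norm_num) (by norm_num)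
          (by norm_num)
        have e : (1 / 2 : ℝ) • (c + lin g x) + (1 / 2 : ℝ) • -(c + lin g (-x)) = lin g x := by
          rw [map_neg]; module
        rwa [e] at this
      have := hmax _ hg
      calc _ = ENNReal.ofReal |(g : Matrix (Fin n) (Fin n) ℝ).det| *
              MeasureTheory.volume (closedBall (0 : E n) 1) := volume_ellipsoid _ c
        _ ≤ 1 * MeasureTheory.volume (closedBall (0 : E n) 1) := by
            gcongr; exact ENNReal.ofReal_le_one.2 this
        _ = _ := one_mul _

/-- The bodies in `J(n)` are uniformly bounded. (The bound `2 ^ n` is not sharp: John's theorem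
gives `√n`.) -/
theorem norm_le_of_mem_J {n : ℕ} {A : SymmBody n} (hA : A ∈ J n) {x : E n}
    (hx : x ∈ (A.1 : Set (E n))) : ‖x‖ ≤ 2 ^ n := by
  obtain ⟨hsub, hmax⟩ := (mem_J_iff A).1 hA
  by_cases hx0 : x = 0
  · simp [hx0]
  have hxn : 0 < ‖x‖ := norm_pos_iff.2 hx0
  set e : E n := ‖x‖⁻¹ • x with he
  have hen : ‖e‖ = 1 := norm_smul_inv_norm (𝕜 := ℝ) hx0
  -- The average of the ball and the segment `[-x, x]` contains an ellipsoid stretched along `x`.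
  have hM := hmax ((1 / 2 : ℝ) • (1 + vecMulVec x.ofLp e.ofLp)) (by
    rw [map_smul, map_add]
    refine mapsTo_average A (fun y hy => hsub (by simpa using hy)) fun y hy => ?_
    have h1 : toEuclideanCLM (n := Fin n) (𝕜 := ℝ) (vecMulVec x.ofLp e.ofLp) y =
        inner ℝ e y • x := by
      apply WithLp.ofLp_injective
      rw [ofLp_toEuclideanCLM, vecMulVec_mulVec]
      ext i
      simp [EuclideanSpace.inner_eq_star_dotProduct, dotProduct_comm, mul_comm]
    rw [h1]
    have h2 : |inner ℝ e y| ≤ 1 := by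
      have := abs_real_inner_le_norm e y
      rw [hen, one_mul] at this
      exact this.trans (by simpa using hy)
    rw [abs_le] at h2
    have := A.1.convex hx (A.2.1 x hx) (a := (1 + inner ℝ e y) / 2) (b := (1 - inner ℝ e y) / 2)
      (by linarith) (by linarith) (by ring)
    convert this using 1
    module)
  rw [det_smul, Fintype.card_fin, vecMulVec_eq Unit, det_one_add_replicateCol_mul_replicateRow] at hM
  have h3 : e.ofLp ⬝ᵥ x.ofLp = ‖x‖ := by
    have : inner ℝ x e = ‖x‖ := by
      rw [he, inner_smul_right, real_inner_self_eq_norm_sq]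
      field_simp
    rw [← this, EuclideanSpace.inner_eq_star_dotProduct]
    simp
  rw [h3, abs_of_nonneg (by positivity), one_div, inv_pow, inv_mul_le_iff₀ (by positivity)] at hM
  linarith

/-! ### Uniqueness of the maximal ellipsoid -/

theorem mem_O_iff {n : ℕ} {g : GL (Fin n) ℝ} :
    g ∈ O n ↔ (g : Matrix (Fin n) (Fin n) ℝ) * star (g : Matrix (Fin n) (Fin n) ℝ) = 1 :=
  mem_unitaryGroup_iff

/-- The equality case of `∏ √sᵢ ≤ ∏ (1 + sᵢ) / 2`. -/
theorem eq_one_of_prod_half_one_add_le {ι : Type*} [Fintype ι] {s : ι → ℝ} (hs : ∀ i, 0 < s i)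
    (hprod : ∏ i, s i = 1) (hle : ∏ i, ((1 + s i) / 2) ≤ 1) (i : ι) : s i = 1 := by
  by_contra hi
  have h : ∏ i, s i < ∏ i, ((1 + s i) / 2) ^ 2 := by
    refine Finset.prod_lt_prod (fun j _ => hs j) (fun j _ => ?_) ⟨i, Finset.mem_univ i, ?_⟩
    · nlinarith [sq_nonneg (1 - s j)]
    · have : 0 < (1 - s i) ^ 2 := by
        have : 1 - s i ≠ 0 := fun h => hi (by linarith)
        positivity
      nlinarith
  rw [hprod, Finset.prod_pow] at h
  have h0 : 0 ≤ ∏ i, ((1 + s i) / 2) := Finset.prod_nonneg fun j _ => by linarith [hs j]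
  nlinarith

theorem conj_diagonal_mul {n : ℕ} {U : Matrix (Fin n) (Fin n) ℝ} (hU : star U * U = 1)
    (d d' : Fin n → ℝ) :
    (U * Matrix.diagonal d * star U) * (U * Matrix.diagonal d' * star U) =
      U * Matrix.diagonal (fun i => d i * d' i) * star U := by
  rw [← diagonal_mul_diagonal]
  calc _ = U * Matrix.diagonal d * (star U * U) * Matrix.diagonal d' * star U := by
        simp only [mul_assoc]
    _ = _ := by rw [hU]; simp only [mul_assoc, one_mul]

theorem star_conj_diagonal {n : ℕ} (U : Matrix (Fin n) (Fin n) ℝ) (d : Fin n → ℝ) :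
    star (U * Matrix.diagonal d * star U) = U * Matrix.diagonal d * star U := by
  rw [star_mul, star_mul, star_star, star_eq_conjTranspose (Matrix.diagonal d),
    diagonal_conjTranspose, mul_assoc]
  simp

theorem det_conj_diagonal {n : ℕ} {U : Matrix (Fin n) (Fin n) ℝ} (hU : U * star U = 1)
    (d : Fin n → ℝ) : (U * Matrix.diagonal d * star U).det = ∏ i, d i := by
  rw [det_mul_right_comm, hU, one_mul, det_diagonal]

/-- Polar decomposition: an invertible `h` times a suitable orthogonal `k` is positive definite,
here given in diagonalized form. -/
theorem exists_mul_orthogonal_eq_conj_diagonal {n : ℕ} {h : Matrix (Fin n) (Fin n) ℝ}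
    (hdet : h.det ≠ 0) :
    ∃ (U k : Matrix (Fin n) (Fin n) ℝ) (s : Fin n → ℝ), U * star U = 1 ∧ k * star k = 1 ∧
      (∀ i, 0 < s i) ∧ h * k = U * Matrix.diagonal s * star U := by
  have hunit : IsUnit h := (isUnit_iff_isUnit_det h).2 hdet.isUnit
  have hS : (h * star h).PosDef :=
    PosDef.mul_conjTranspose_self h (vecMul_injective_iff_isUnit.2 hunit)
  obtain ⟨U, lam, hU1, hlam, hspec⟩ : ∃ (U : Matrix (Fin n) (Fin n) ℝ) (lam : Fin n → ℝ),
      U * star U = 1 ∧ (∀ i, 0 < lam i) ∧ h * star h = U * Matrix.diagonal lam * star U := by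
    refine ⟨hS.isHermitian.eigenvectorUnitary.1, hS.isHermitian.eigenvalues,
      mem_unitaryGroup_iff.1 hS.isHermitian.eigenvectorUnitary.2, hS.eigenvalues_pos, ?_⟩
    have := hS.isHermitian.spectral_theorem
    rw [Unitary.conjStarAlgAut_apply] at this
    exact this
  clear hS
  have hU2 : star U * U = 1 := mul_eq_one_comm.1 hU1
  set s : Fin n → ℝ := fun i => √(lam i) with hsdef
  have hspos : ∀ i, 0 < s i := fun i => Real.sqrt_pos.2 (hlam i)
  obtain ⟨P, hP⟩ : ∃ P, P = U * Matrix.diagonal s * star U := ⟨_, rfl⟩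
  obtain ⟨Q, hQ⟩ : ∃ Q, Q = U * Matrix.diagonal (fun i => (s i)⁻¹) * star U := ⟨_, rfl⟩
  have hPQ : P * Q = 1 := by
    rw [hP, hQ, conj_diagonal_mul hU2]
    simp only [fun i => mul_inv_cancel₀ (hspos i).ne', diagonal_one, mul_one, hU1]
  have hPP : P * P = h * star h := by
    rw [hP, conj_diagonal_mul hU2, hspec]
    simp only [hsdef, fun i => Real.mul_self_sqrt (hlam i).le]
  have hQP : Q * P = 1 := mul_eq_one_comm.1 hPQ
  have hQstar : star Q = Q := by rw [hQ, star_conj_diagonal]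
  have hk : (Q * h) * star (Q * h) = 1 := by
    rw [star_mul, hQstar]
    calc _ = Q * (h * star h) * Q := by simp only [mul_assoc]
      _ = (Q * P) * (P * Q) := by rw [← hPP]; simp only [mul_assoc]
      _ = 1 := by rw [hPQ, hQP, one_mul]
  refine ⟨U, star (Q * h), s, hU1, ?_, hspos, ?_⟩
  · rw [star_star]; exact mul_eq_one_comm.1 hk
  · rw [← hP]
    calc _ = (P * Q) * h * star (Q * h) := by rw [hPQ, one_mul]
      _ = P * ((Q * h) * star (Q * h)) := by simp only [mul_assoc]
      _ = P := by rw [hk, mul_one]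

/-- Uniqueness of the maximal ellipsoid: `h` maps the unit ball onto an ellipsoid of the same
volume inside `A`, hence onto the unit ball itself. -/
theorem mem_orthogonalGroup_of_mapsTo {n : ℕ} {A : SymmBody n} (hA : A ∈ J n)
    {h : Matrix (Fin n) (Fin n) ℝ} (hdet : |h.det| = 1)
    (hh : MapsTo (toEuclideanCLM (n := Fin n) (𝕜 := ℝ) h) (closedBall 0 1) (A.1 : Set (E n))) :
    h * star h = 1 := by
  obtain ⟨hsub, hmax⟩ := (mem_J_iff A).1 hA
  obtain ⟨U, k, s, hU, hk, hspos, hP⟩ := exists_mul_orthogonal_eq_conj_diagonal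
    (h := h) fun h0 => by simp [h0] at hdet
  have hPmaps : MapsTo (toEuclideanCLM (n := Fin n) (𝕜 := ℝ) (h * k)) (closedBall 0 1)
      (A.1 : Set (E n)) := by
    intro x hx
    rw [map_mul]
    refine hh ?_
    have hkO : (⟨k, star k, hk, mul_eq_one_comm.1 hk⟩ : GL (Fin n) ℝ) ∈ O n := mem_O_iff.2 hk
    have := norm_lin_of_mem hkO x
    rw [mem_closedBall_zero_iff] at hx ⊢
    exact this.trans_le hx
  have havg : MapsTo (toEuclideanCLM (n := Fin n) (𝕜 := ℝ) ((1 / 2 : ℝ) • (1 + h * k)))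
      (closedBall 0 1) (A.1 : Set (E n)) := by
    rw [map_smul, map_add]
    exact mapsTo_average A (fun y hy => hsub (by simpa using hy)) hPmaps
  -- The determinant of `(1 + hk)/2` is the product of the averages `(1 + sᵢ)/2`.
  have hform : (1 / 2 : ℝ) • (1 + h * k) =
      U * Matrix.diagonal (fun i => (1 + s i) / 2) * star U := by
    have h1 : (1 / 2 : ℝ) • (1 + Matrix.diagonal s) = Matrix.diagonal fun i => (1 + s i) / 2 := by
      rw [← diagonal_one, diagonal_add, ← diagonal_smul]
      congr 1; ext i; simp; ring
    rw [hP, ← h1, mul_smul_comm, smul_mul_assoc, mul_add, add_mul, mul_one, hU]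
  have hle := hmax _ havg
  rw [hform, det_conj_diagonal hU] at hle
  have hkdet : |k.det| = 1 := by
    have h1 := congrArg Matrix.det hk
    rw [det_mul, star_eq_conjTranspose, det_conjTranspose, star_trivial, det_one] at h1
    exact (abs_eq zero_le_one).2 (mul_self_eq_one_iff.1 h1)
  have hprod : ∏ i, s i = 1 := by
    rw [← abs_of_pos (Finset.prod_pos fun i _ => hspos i), ← det_conj_diagonal hU, ← hP, det_mul,
      abs_mul, hdet, hkdet, one_mul]
  have hs1 := eq_one_of_prod_half_one_add_le hspos hprod ((le_abs_self _).trans hle)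
  have hhk : h * k = 1 := by
    rw [hP, funext hs1, diagonal_one, mul_one, hU]
  have : h = star k := by
    calc h = h * (k * star k) := by rw [hk, mul_one]
      _ = star k := by rw [← mul_assoc, hhk, one_mul]
  rw [this, star_star]
  exact mul_eq_one_comm.1 hk

/-- A `GL(n)`-orbit meets `J(n)` in at most one `O(n)`-orbit. -/
theorem mem_O_of_smul_mem_J {n : ℕ} {A : SymmBody n} {g : GL (Fin n) ℝ} (hA : A ∈ J n)
    (hgA : g • A ∈ J n) : g ∈ O n := by
  obtain ⟨hsub, hmax⟩ := (mem_J_iff A).1 hA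
  obtain ⟨hsub', hmax'⟩ := (mem_J_iff _).1 hgA
  have hinv : MapsTo (lin g⁻¹) (closedBall 0 1) (A.1 : Set (E n)) := by
    intro x hx
    obtain ⟨y, hy, hyx⟩ := hsub' hx
    rw [← hyx, lin_inv_lin]
    exact hy
  have h1 := hmax _ hinv
  have h2 := hmax' g fun x hx => ⟨x, hsub hx, rfl⟩
  have h3 : |(g : Matrix (Fin n) (Fin n) ℝ).det| *
      |((g⁻¹ : GL (Fin n) ℝ) : Matrix (Fin n) (Fin n) ℝ).det| = 1 := by
    rw [← abs_mul, ← det_mul, ← Units.val_mul, mul_inv_cancel]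
    simp
  have h4 : |((g⁻¹ : GL (Fin n) ℝ) : Matrix (Fin n) (Fin n) ℝ).det| = 1 := by
    refine le_antisymm h1 (h3.ge.trans (mul_le_of_le_one_left (abs_nonneg _) h2))
  have := mem_O_iff.2 (mem_orthogonalGroup_of_mapsTo hA h4 hinv)
  simpa using inv_mem this

/-! ### Existence of a maximal ellipsoid -/

theorem exists_closedBall_subset {n : ℕ} (A : SymmBody n) :
    ∃ r > 0, closedBall (0 : E n) r ⊆ (A.1 : Set (E n)) := by
  obtain ⟨x, hx⟩ := A.2.2
  obtain ⟨r, hr, hball⟩ := nhds_basis_closedBall.mem_iff.1 (mem_interior_iff_mem_nhds.1 hx)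
  refine ⟨r, hr, fun y hy => ?_⟩
  have h1 : x + y ∈ (A.1 : Set (E n)) := hball (by simpa using hy)
  have h2 : -(x - y) ∈ (A.1 : Set (E n)) := A.2.1 _ (hball (by simpa using hy))
  have := A.1.convex h1 h2 (a := 1 / 2) (b := 1 / 2) (by norm_num) (by norm_num) (by norm_num)
  have e : (1 / 2 : ℝ) • (x + y) + (1 / 2 : ℝ) • -(x - y) = y := by module
  rwa [e] at this

/-- Every `GL(n)`-orbit meets `J(n)`: normalize a linear image of the ball in `A` of maximal
volume. -/
theorem exists_smul_mem_J {n : ℕ} (A : SymmBody n) : ∃ g : GL (Fin n) ℝ, g • A ∈ J n := by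
  obtain ⟨r, hr, hrA⟩ := exists_closedBall_subset A
  obtain ⟨R, hR⟩ := A.1.isBounded.subset_closedBall 0
  set S : Set (E n →L[ℝ] E n) := {f | MapsTo f (closedBall 0 1) (A.1 : Set (E n))} with hS
  have hmemS : r • ContinuousLinearMap.id ℝ (E n) ∈ S := by
    intro x hx
    refine hrA ?_
    rw [mem_closedBall_zero_iff] at hx ⊢
    simp only [_root_.smul_apply, ContinuousLinearMap.id_apply, norm_smul,
      Real.norm_eq_abs, abs_of_pos hr]
    nlinarith
  have hcompact : IsCompact S := by
    refine (isCompact_closedBall (0 : E n →L[ℝ] E n) (max R 0)).of_isClosed_subset ?_ ?_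
    · have : S = ⋂ x ∈ closedBall (0 : E n) 1, {f | f x ∈ (A.1 : Set (E n))} := by
        ext f; simp [hS, MapsTo]
      rw [this]
      exact isClosed_biInter fun x _ => A.1.isClosed.preimage (by fun_prop)
    · intro f hf
      rw [mem_closedBall_zero_iff]
      refine f.opNorm_le_of_unit_norm (le_max_right _ _) fun x hx => ?_
      have := hR (hf (mem_closedBall_zero_iff.2 hx.le))
      exact (mem_closedBall_zero_iff.1 this).trans (le_max_left _ _)
  obtain ⟨f, hfS, hfmax⟩ := hcompact.exists_isMaxOn ⟨_, hmemS⟩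
    (f := fun f : E n →L[ℝ] E n => |f.det|)
    ContinuousLinearMap.continuous_det.abs.continuousOn
  obtain ⟨M, rfl⟩ := (toEuclideanCLM (n := Fin n) (𝕜 := ℝ)).surjective f
  have hMdet : 0 < |M.det| := by
    have h1 : |(r • ContinuousLinearMap.id ℝ (E n)).det| ≤
        |(toEuclideanCLM (n := Fin n) (𝕜 := ℝ) M).det| := hfmax hmemS
    refine lt_of_lt_of_le ?_ (h1.trans_eq (congrArg abs (det_toEuclideanCLM M)))
    have : (r • ContinuousLinearMap.id ℝ (E n)).det = r ^ n := by
      have e : r • ContinuousLinearMap.id ℝ (E n) =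
          toEuclideanCLM (n := Fin n) (𝕜 := ℝ) (r • 1) := by rw [map_smul, map_one]; rfl
      rw [e, det_toEuclideanCLM, det_smul, det_one]; simp
    rw [this]
    positivity
  set g : GL (Fin n) ℝ := GeneralLinearGroup.mkOfDetNeZero M (abs_pos.1 hMdet) with hg
  refine ⟨g⁻¹, (mem_J_iff _).2 ⟨fun x hx => ⟨lin g x, hfS hx, lin_inv_lin g x⟩, fun N hN => ?_⟩⟩
  have hMN : toEuclideanCLM (n := Fin n) (𝕜 := ℝ) (M * N) ∈ S := by
    intro x hx
    obtain ⟨y, hy, hyx⟩ := hN hx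
    rw [map_mul]
    change lin g (toEuclideanCLM (n := Fin n) (𝕜 := ℝ) N x) ∈ _
    rw [← hyx, lin_lin_inv]
    exact hy
  have : |(toEuclideanCLM (n := Fin n) (𝕜 := ℝ) (M * N)).det| ≤
      |(toEuclideanCLM (n := Fin n) (𝕜 := ℝ) M).det| := hfmax hMN
  rw [det_toEuclideanCLM, det_toEuclideanCLM, det_mul, abs_mul] at this
  exact (mul_le_iff_le_one_right hMdet).1 this

/-! ### The Hausdorff topology on symmetric bodies -/

/-- A symmetric convex body regarded as a nonempty compact set. -/
def toNonemptyCompacts {n : ℕ} (A : SymmBody n) : NonemptyCompacts (E n) :=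
  ⟨⟨A.1, A.1.isCompact⟩, A.1.nonempty⟩

theorem isometry_toNonemptyCompacts {n : ℕ} : Isometry (toNonemptyCompacts (n := n)) :=
  Isometry.of_dist_eq fun _ _ => rfl

theorem isEmbedding_toNonemptyCompacts {n : ℕ} : IsEmbedding (toNonemptyCompacts (n := n)) :=
  isometry_toNonemptyCompacts.isEmbedding

instance secondCountable_symmBody (n : ℕ) : SecondCountableTopology (SymmBody n) :=
  isEmbedding_toNonemptyCompacts.secondCountableTopology

instance continuousConstSMul_symmBody (n : ℕ) :
    ContinuousConstSMul (GL (Fin n) ℝ) (SymmBody n) where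
  continuous_const_smul g := by
    rw [isEmbedding_toNonemptyCompacts.continuous_iff]
    exact (lin g).continuous.nonemptyCompacts_map.comp isEmbedding_toNonemptyCompacts.continuous

theorem exists_dist_lt_of_dist_lt {X : Type*} [MetricSpace X] {K L : NonemptyCompacts X} {ε : ℝ}
    (h : dist K L < ε) {x : X} (hx : x ∈ (K : Set X)) : ∃ y ∈ (L : Set X), dist x y < ε :=
  exists_dist_lt_of_hausdorffDist_lt hx h (edist_ne_top K L)

/-! ### Compactness of `J(n)` -/

theorem isClosed_setOf_convex {n : ℕ} :
    IsClosed {K : NonemptyCompacts (E n) | Convex ℝ (K : Set (E n))} := by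
  refine isClosed_of_closure_subset fun K hK x hx y hy a b ha hb hab => ?_
  rw [← K.isCompact.isClosed.closure_eq, Metric.mem_closure_iff]
  intro ε hε
  obtain ⟨L, hL, hKL⟩ := Metric.mem_closure_iff.1 hK (ε / 2) (half_pos hε)
  obtain ⟨x', hx', hxx'⟩ := exists_dist_lt_of_dist_lt hKL hx
  obtain ⟨y', hy', hyy'⟩ := exists_dist_lt_of_dist_lt hKL hy
  obtain ⟨z, hz, hzz⟩ := exists_dist_lt_of_dist_lt (by rwa [dist_comm]) (hL hx' hy' ha hb hab)
  refine ⟨z, hz, ?_⟩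
  have h1 : dist (a • x + b • y) (a • x' + b • y') ≤ ε / 2 := by
    refine (dist_add_add_le _ _ _ _).trans ?_
    rw [dist_smul₀, dist_smul₀, Real.norm_of_nonneg ha, Real.norm_of_nonneg hb]
    calc _ ≤ a * (ε / 2) + b * (ε / 2) := by gcongr
      _ = ε / 2 := by rw [← add_mul, hab, one_mul]
  linarith [dist_triangle (a • x + b • y) (a • x' + b • y') z]

theorem isClosed_setOf_neg_mem {n : ℕ} :
    IsClosed {K : NonemptyCompacts (E n) | ∀ x ∈ (K : Set (E n)), -x ∈ (K : Set (E n))} := by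
  refine isClosed_of_closure_subset fun K hK x hx => ?_
  rw [← K.isCompact.isClosed.closure_eq, Metric.mem_closure_iff]
  intro ε hε
  obtain ⟨L, hL, hKL⟩ := Metric.mem_closure_iff.1 hK (ε / 2) (half_pos hε)
  obtain ⟨x', hx', hxx'⟩ := exists_dist_lt_of_dist_lt hKL hx
  obtain ⟨z, hz, hzz⟩ := exists_dist_lt_of_dist_lt (by rwa [dist_comm]) (hL x' hx')
  refine ⟨z, hz, ?_⟩
  have h1 : dist (-x) (-x') < ε / 2 := by rwa [dist_neg_neg]
  linarith [dist_triangle (-x) (-x') z]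

theorem isClosed_setOf_subset {n : ℕ} (s : Set (E n)) :
    IsClosed {K : NonemptyCompacts (E n) | s ⊆ (K : Set (E n))} := by
  have : {K : NonemptyCompacts (E n) | s ⊆ (K : Set (E n))} =
      ⋂ x ∈ s, {K : NonemptyCompacts (E n) | ((K : Set (E n)) ∩ {x}).Nonempty} := by
    ext K; simp [subset_def]
  rw [this]
  exact isClosed_biInter fun x _ =>
    NonemptyCompacts.isClosed_inter_nonempty_of_isClosed isClosed_singleton

/-- If `L` contains the unit ball, then a set within Hausdorff distance `ε` of `L` lies in
`(1 + ε) L`. -/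
theorem inv_one_add_smul_mem {n : ℕ} {K L : NonemptyCompacts (E n)} {ε : ℝ} (hKL : dist K L < ε)
    (hL : Convex ℝ (L : Set (E n))) (hball : closedBall (0 : E n) 1 ⊆ (L : Set (E n)))
    {x : E n} (hx : x ∈ (K : Set (E n))) : (1 + ε)⁻¹ • x ∈ (L : Set (E n)) := by
  have hε : 0 < ε := dist_nonneg.trans_lt hKL
  obtain ⟨y, hy, hxy⟩ := exists_dist_lt_of_dist_lt hKL hx
  have hb : ε⁻¹ • (x - y) ∈ (L : Set (E n)) := by
    refine hball ?_
    rw [mem_closedBall_zero_iff, norm_smul, norm_inv, Real.norm_of_nonneg hε.le,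
      inv_mul_le_iff₀ hε, mul_one, ← dist_eq_norm]
    exact hxy.le
  have := hL hy hb (a := (1 + ε)⁻¹) (b := (1 + ε)⁻¹ * ε) (by positivity) (by positivity)
    (by field_simp)
  rwa [smul_smul, mul_assoc, mul_inv_cancel₀ hε.ne', mul_one, ← smul_add,
    add_sub_cancel] at this

/-- The interior of such a set `K` is automatically nonempty, so the image of `J(n)` is cut out by
conditions which survive limits. -/
theorem image_J_eq {n : ℕ} : toNonemptyCompacts '' (J n : Set (SymmBody n)) =
    {K : NonemptyCompacts (E n) | (K : Set (E n)) ⊆ closedBall 0 (2 ^ n)} ∩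
    {K : NonemptyCompacts (E n) | Convex ℝ (K : Set (E n)) ∧
      (∀ x ∈ (K : Set (E n)), -x ∈ (K : Set (E n))) ∧
      closedBall (0 : E n) 1 ⊆ (K : Set (E n)) ∧
      ∀ M : Matrix (Fin n) (Fin n) ℝ,
        MapsTo (toEuclideanCLM (n := Fin n) (𝕜 := ℝ) M) (closedBall 0 1) (K : Set (E n)) →
          |M.det| ≤ 1} := by
  ext K
  constructor
  · rintro ⟨A, hA, rfl⟩
    have h := (mem_J_iff A).1 hA
    exact ⟨fun x hx => mem_closedBall_zero_iff.2 (norm_le_of_mem_J hA hx), A.1.convex, A.2.1,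
      h.1, h.2⟩
  · rintro ⟨-, hconv, hneg, hball, hmax⟩
    have hint : (interior (K : Set (E n))).Nonempty :=
      ⟨0, mem_interior_iff_mem_nhds.2 (mem_of_superset (closedBall_mem_nhds 0 one_pos) hball)⟩
    exact ⟨⟨⟨K, hconv, K.isCompact, K.nonempty⟩, hneg, hint⟩, (mem_J_iff _).2 ⟨hball, hmax⟩, rfl⟩

theorem isCompact_J (n : ℕ) : IsCompact (J n : Set (SymmBody n)) := by
  rw [isEmbedding_toNonemptyCompacts.isCompact_iff, image_J_eq]
  refine (NonemptyCompacts.isCompact_subsets_of_isCompact (isCompact_closedBall _ _)).inter_right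
    (isClosed_of_closure_subset fun K hK => ?_)
  refine ⟨closure_minimal (fun L hL => hL.1) isClosed_setOf_convex hK,
    closure_minimal (fun L hL => hL.2.1) isClosed_setOf_neg_mem hK,
    closure_minimal (fun L hL => hL.2.2.1) (isClosed_setOf_subset _) hK, fun M hM => ?_⟩
  -- Shrinking `M` by `1 + ε` makes it admissible for a nearby body; then let `ε → 0`.
  have key : ∀ ε > 0, |M.det| ≤ (1 + ε) ^ n := by
    intro ε hε
    obtain ⟨L, ⟨hconv, -, hball, hmax⟩, hKL⟩ := Metric.mem_closure_iff.1 hK ε hε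
    have := hmax ((1 + ε)⁻¹ • M) fun x hx => by
      rw [map_smul]
      exact inv_one_add_smul_mem hKL hconv hball (hM hx)
    rw [det_smul, Fintype.card_fin, abs_mul, abs_of_pos (by positivity), inv_pow,
      inv_mul_le_iff₀ (by positivity), mul_one] at this
    exact this
  have hlim : Tendsto (fun ε : ℝ => (1 + ε) ^ n) (𝓝[>] 0) (𝓝 1) := by
    have : Tendsto (fun ε : ℝ => (1 + ε) ^ n) (𝓝 0) (𝓝 ((1 + 0) ^ n)) :=
      Continuous.tendsto (by fun_prop) 0
    simp only [add_zero, one_pow] at this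
    exact this.mono_left nhdsWithin_le_nhds
  exact ge_of_tendsto hlim (eventually_mem_nhdsWithin.mono fun ε hε => key ε hε)

/-! ### Closedness of the orbit relation -/

/-- If `A ⊇ B(0, r)`, every body `A'` near `A` satisfies `A' + B(0, r/2) ⊇ B(0, r)`, so that
`r ‖f x‖ ≤ R + ‖f‖ r/2` for unit vectors `x`. -/
theorem norm_le_of_image_subset {n : ℕ} {A A' : SymmBody n} {r R : ℝ} (hr : 0 < r)
    (hA : closedBall (0 : E n) r ⊆ (A.1 : Set (E n))) (hAA' : dist A A' < r / 2)
    {f : E n →L[ℝ] E n} (hf : f '' (A'.1 : Set (E n)) ⊆ closedBall 0 R) :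
    ‖f‖ ≤ 2 * R / r := by
  have hR : 0 ≤ R := by
    obtain ⟨y, hy⟩ := A'.1.nonempty
    exact (norm_nonneg _).trans (mem_closedBall_zero_iff.1 (hf ⟨y, hy, rfl⟩))
  have hhalf : ‖f‖ ≤ R / r + ‖f‖ / 2 := by
    refine f.opNorm_le_of_unit_norm (by positivity) fun x hx => ?_
    have hrx : r • x ∈ (A.1 : Set (E n)) := hA (by
      rw [mem_closedBall_zero_iff, norm_smul, hx, mul_one, Real.norm_of_nonneg hr.le])
    obtain ⟨a, ha, hxa⟩ := exists_dist_lt_of_dist_lt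
      (K := toNonemptyCompacts A) (L := toNonemptyCompacts A') hAA' hrx
    have h1 : ‖f a‖ ≤ R := mem_closedBall_zero_iff.1 (hf ⟨a, ha, rfl⟩)
    have h2 : ‖f (r • x - a)‖ ≤ ‖f‖ * (r / 2) :=
      (f.le_opNorm _).trans (by rw [← dist_eq_norm]; gcongr)
    have h3 : r * ‖f x‖ ≤ R + ‖f‖ * (r / 2) := by
      have : f (r • x) = f a + f (r • x - a) := by rw [← map_add, add_sub_cancel]
      calc r * ‖f x‖ = ‖f (r • x)‖ := by
            rw [map_smul, norm_smul, Real.norm_of_nonneg hr.le]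
        _ ≤ _ := by rw [this]; exact (norm_add_le _ _).trans (add_le_add h1 h2)
    rw [← le_div_iff₀' hr] at h3
    refine h3.trans_eq ?_
    field_simp
  have : 2 * R / r = 2 * (R / r) := by ring
  linarith

/-- Inclusions `F k (u k) ⊆ v k` pass to the limit. -/
theorem mapsTo_of_tendsto {n : ℕ} {u v : ℕ → SymmBody n} {A C : SymmBody n}
    (hu : Tendsto u atTop (𝓝 A)) (hv : Tendsto v atTop (𝓝 C)) {F : ℕ → E n →L[ℝ] E n}
    {f : E n →L[ℝ] E n} (hF : Tendsto F atTop (𝓝 f))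
    (hFuv : ∀ k, MapsTo (F k) ((u k).1 : Set (E n)) ((v k).1 : Set (E n))) :
    MapsTo f (A.1 : Set (E n)) (C.1 : Set (E n)) := by
  intro x hx
  have hx' : ∀ k, ∃ y ∈ ((u k).1 : Set (E n)), dist x y < dist A (u k) + 1 / ((k : ℝ) + 1) :=
    fun k => exists_dist_lt_of_dist_lt (K := toNonemptyCompacts A)
      (L := toNonemptyCompacts (u k)) (lt_add_of_pos_right (dist A (u k)) (by positivity)) hx
  choose y hy hxy using hx'
  have hz : ∀ k, ∃ z ∈ (C.1 : Set (E n)),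
      dist (F k (y k)) z < dist (v k) C + 1 / ((k : ℝ) + 1) :=
    fun k => exists_dist_lt_of_dist_lt (K := toNonemptyCompacts (v k))
      (L := toNonemptyCompacts C) (lt_add_of_pos_right (dist (v k) C) (by positivity))
      (hFuv k (hy k))
  choose z hzC hz using hz
  have h0 := tendsto_one_div_add_atTop_nhds_zero_nat (𝕜 := ℝ)
  have hylim : Tendsto y atTop (𝓝 x) := by
    rw [tendsto_iff_dist_tendsto_zero]
    refine squeeze_zero (fun _ => dist_nonneg)
      (fun k => (dist_comm _ _).trans_le (hxy k).le) ?_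
    simpa using ((tendsto_const_nhds (x := A)).dist hu).add h0
  have hFy : Tendsto (fun k => F k (y k)) atTop (𝓝 (f x)) := 
    ((isBoundedBilinearMap_apply (𝕜 := ℝ) (E := E n) (F := E n)).continuous.tendsto (f, x)).comp
      (hF.prodMk_nhds hylim)
  have hzlim : Tendsto z atTop (𝓝 (f x)) := by
    refine hFy.congr_dist (squeeze_zero (fun _ => dist_nonneg) (fun k => (hz k).le) ?_)
    simpa using (hv.dist (tendsto_const_nhds (x := C))).add h0
  exact C.1.isClosed.mem_of_tendsto hzlim (Eventually.of_forall hzC)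

/-- Group elements carrying one convergent sequence of bodies to another are bounded. Applied with
the two sequences exchanged, this also bounds the inverses. -/
theorem exists_norm_lin_le {n : ℕ} {u : ℕ → SymmBody n} {g : ℕ → GL (Fin n) ℝ} {A C : SymmBody n}
    (hu : Tendsto u atTop (𝓝 A)) (hv : Tendsto (fun k => g k • u k) atTop (𝓝 C)) :
    ∃ b : ℝ, ∀ᶠ k in atTop, ‖lin (g k)‖ ≤ b := by
  obtain ⟨r, hr, hrA⟩ := exists_closedBall_subset A
  obtain ⟨R, hR⟩ := C.1.isBounded.subset_closedBall 0
  refine ⟨2 * (R + 1) / r, ?_⟩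
  filter_upwards [hu (ball_mem_nhds A (half_pos hr)), hv (ball_mem_nhds C one_pos)] with k h1 h2
  refine norm_le_of_image_subset hr hrA (by rwa [dist_comm]) (A' := u k) ?_
  rintro _ ⟨x, hx, rfl⟩
  obtain ⟨z, hz, hxz⟩ := exists_dist_lt_of_dist_lt (K := toNonemptyCompacts (g k • u k))
    (L := toNonemptyCompacts C) (x := lin (g k) x) h2 ⟨x, hx, rfl⟩
  rw [mem_closedBall]
  linarith [dist_triangle (lin (g k) x) z 0, mem_closedBall.1 (hR hz)]

/-- The orbit relation of `GL(n)` on `𝓑(n)` is sequentially closed. -/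
theorem mem_orbit_of_tendsto {n : ℕ} {u : ℕ → SymmBody n} {g : ℕ → GL (Fin n) ℝ}
    {A C : SymmBody n} (hu : Tendsto u atTop (𝓝 A))
    (hv : Tendsto (fun k => g k • u k) atTop (𝓝 C)) : C ∈ MulAction.orbit (GL (Fin n) ℝ) A := by
  obtain ⟨b, hb⟩ := exists_norm_lin_le hu hv
  obtain ⟨b', hb'⟩ := exists_norm_lin_le (g := fun k => (g k)⁻¹) hv (by simpa using hu)
  have hcomp : IsCompact (closedBall (0 : E n →L[ℝ] E n) b ×ˢ closedBall (0 : E n →L[ℝ] E n) b') :=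
    (isCompact_closedBall _ _).prod (isCompact_closedBall _ _)
  obtain ⟨⟨f, f'⟩, -, φ, hφ, hlim⟩ := hcomp.tendsto_subseq'
    (x := fun k => (lin (g k), lin (g k)⁻¹)) (Eventually.frequently (by
      filter_upwards [hb, hb'] with k h1 h2
      exact ⟨mem_closedBall_zero_iff.2 h1, mem_closedBall_zero_iff.2 h2⟩))
  have hf : Tendsto (fun k => lin (g (φ k))) atTop (𝓝 f) := (continuous_fst.tendsto _).comp hlim
  have hf' : Tendsto (fun k => lin (g (φ k))⁻¹) atTop (𝓝 f') :=
    (continuous_snd.tendsto _).comp hlim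
  have hmul : f * f' = 1 := by
    refine tendsto_nhds_unique (hf.mul hf') ?_
    refine tendsto_const_nhds.congr fun k => ?_
    exact (lin_one.symm.trans (by rw [← mul_inv_cancel (g (φ k)), lin_mul]; rfl))
  have hmul' : f' * f = 1 := by
    refine tendsto_nhds_unique (hf'.mul hf) ?_
    refine tendsto_const_nhds.congr fun k => ?_
    exact (lin_one.symm.trans (by rw [← inv_mul_cancel (g (φ k)), lin_mul]; rfl))
  have hmaps : MapsTo f (A.1 : Set (E n)) (C.1 : Set (E n)) :=
    mapsTo_of_tendsto (hu.comp hφ.tendsto_atTop) (hv.comp hφ.tendsto_atTop) hf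
      fun k x hx => ⟨x, hx, rfl⟩
  have hmaps' : MapsTo f' (C.1 : Set (E n)) (A.1 : Set (E n)) := by
    refine mapsTo_of_tendsto (hv.comp hφ.tendsto_atTop) (hu.comp hφ.tendsto_atTop) hf' fun k => ?_
    rintro _ ⟨x, hx, rfl⟩
    rw [lin_inv_lin]
    exact hx
  let e := toEuclideanCLM (n := Fin n) (𝕜 := ℝ)
  let g₀ : GL (Fin n) ℝ := ⟨e.symm f, e.symm f', by rw [← map_mul, hmul, map_one],
    by rw [← map_mul, hmul', map_one]⟩
  have hg₀ : lin g₀ = f := e.apply_symm_apply f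
  refine ⟨g₀, Subtype.ext (ConvexBody.ext ?_)⟩
  change lin g₀ '' (A.1 : Set (E n)) = C.1
  rw [hg₀]
  refine Subset.antisymm hmaps.image_subset fun y hy => ⟨f' y, hmaps' hy, ?_⟩
  exact congrArg (fun F : E n →L[ℝ] E n => F y) hmul

/-! ### The orbit spaces and the induced map -/

instance t2Space_BM (n : ℕ) : T2Space (BM n) := by
  refine (t2Space_iff_of_isOpenQuotientMap
    (MulAction.isOpenQuotientMap_quotientMk (Γ := GL (Fin n) ℝ) (T := SymmBody n))).2 ?_
  refine IsSeqClosed.isClosed fun x p hx hp => ?_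
  have hx' : ∀ k, ∃ g : GL (Fin n) ℝ, g • (x k).2 = (x k).1 := fun k => Quotient.exact (hx k)
  choose g hg using hx'
  refine Quotient.sound (?_ : p.1 ∈ MulAction.orbit _ p.2)
  refine mem_orbit_of_tendsto (g := g) ((continuous_snd.tendsto p).comp hp) ?_
  exact ((continuous_fst.tendsto p).comp hp).congr fun k => (hg k).symm

instance secondCountable_BM (n : ℕ) : SecondCountableTopology (BM n) :=
  ContinuousConstSMul.secondCountableTopology (Γ := GL (Fin n) ℝ) (T := SymmBody n)

instance compactSpace_JModO (n : ℕ) : CompactSpace (JModO n) :=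
  have : CompactSpace (J n) := isCompact_iff_compactSpace.1 (isCompact_J n)
  Quotient.compactSpace

theorem continuous_inducedMap (n : ℕ) : Continuous (inducedMap n) :=
  continuous_subtype_val.quotient_map' _

theorem injective_inducedMap (n : ℕ) : Function.Injective (inducedMap n) := by
  rintro ⟨A⟩ ⟨B⟩ h
  obtain ⟨g, hg⟩ : ∃ g : GL (Fin n) ℝ, g • (B : SymmBody n) = A := Quotient.exact h
  refine Quotient.sound ⟨⟨g, mem_O_of_smul_mem_J B.2 (?_ : g • (B : SymmBody n) ∈ J n)⟩,
    Subtype.ext hg⟩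
  rw [hg]
  exact A.2

theorem surjective_inducedMap (n : ℕ) : Function.Surjective (inducedMap n) := by
  rintro ⟨A⟩
  obtain ⟨g, hg⟩ := exists_smul_mem_J A
  exact ⟨Quotient.mk _ ⟨g • A, hg⟩, Quotient.sound ⟨g, rfl⟩⟩

end BanachMazur

theorem mainTheorem5 (n : ℕ) (hn : 1 ≤ n) :
    CompactSpace (BanachMazur.BM n) ∧
    TopologicalSpace.MetrizableSpace (BanachMazur.BM n) ∧
    IsHomeomorph (BanachMazur.inducedMap n) := by
  have hcont := BanachMazur.continuous_inducedMap n
  have hsurj := BanachMazur.surjective_inducedMap n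
  have : CompactSpace (BanachMazur.BM n) := hsurj.compactSpace hcont
  exact ⟨this, TopologicalSpace.metrizableSpace_of_t3_secondCountable _,
    isHomeomorph_iff_continuous_bijective.2
      ⟨hcont, BanachMazur.injective_inducedMap n, hsurj⟩⟩
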